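/- Let $q\ge 4$ be a prime power and let $\mathbb F_{q^2}$ be the field with $q^2$ elements. The Hermitian unital $\mathscr U_q$ is the set of points $\langle X,Y,Z\rangle$ of the projective plane $PG(2,q^2)$ over $\mathbb F_{q^2}$ with $X^{q+1}+Y^{q+1}+Z^{q+1}=0$. A secant is a line of $PG(2,q^2)$ that meets $\mathscr U_q$ in exactly $q+1$ points. Let $H_q$ be the graph whose vertices are the secants, in which two distinct secants are adjacent if and only if their intersection point lies in $\mathscr U_q$. Let $\mathscr T_q$ be the set of non-degenerate triangles of $H_q$, i.e. the sets of three distinct secants $\ell_1,\ell_2,\ell_3$ such that the three points $\ell_1\cap\ell_2$, $\ell_1\cap\ell_3$, $\ell_2\cap\ell_3$ lie in $\mathscr U_q$ and are distinct. Then $H_q$ has exactly $q^4-q^3+q^2$ vertices and is quasi-Folkman with distinguished family $\mathscr T_q$, that is: (1) no four triangles in $\mathscr T_q$ induce a $K_4$ in $H_q$ (there is no $K_4$ in $H_q$ all four of whose triangles belong to $\mathscr T_q$); (2) for every colouring of the edges of $H_q$ with two colours there is a triangle in $\mathscr T_q$ whose three edges have the same colour. Moreover, there is a function $\delta$ with $\delta(q)\to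 0$ as $q\to\infty$ such that, for every prime power $q\ge 4$, every colouring of the edges of $H_q$ with two colours has at least $\left(\frac14-\delta(q)\right)|\mathscr T_q|$ monochromatic triangles in $\mathscr T_q$. -/

import Mathlib

open scoped LinearAlgebra.Projectivization

universe u v

/-! ### Quasi-Folkman graphs -/

namespace QuasiFolkman

variable {V : Type v}

/-- The triangle with vertex set `t` is monochromatic under the edge colouring `Δ` of `G`:
all edges of `G` with both endpoints in `t` have the same colour. -/
def IsMonochromatic {G : SimpleGraph V} (Δ : G.edgeSet → Fin 2) (t : Finset V) : Prop :=
  ∃ c : Fin 2, ∀ e : G.edgeSet, (∀ x ∈ (e : Sym2 V), x ∈ t) → Δ e = c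

/-- `G` is quasi-Folkman with distinguished family `T`.  Triangles are given by their vertex sets.
A `K₄` of `G` on a vertex set `K` has exactly four triangles, namely the `3`-subsets of `K`, so
that four triangles of `T` induce this `K₄` exactly when all `3`-subsets of `K` belong to `T`. -/
structure IsQuasiFolkman (G : SimpleGraph V) (T : Set (Finset V)) : Prop where
  /-- `T` is a family of triangles of `G`. -/
  isTriangle : ∀ t ∈ T, G.IsNClique 3 t
  /-- No four triangles in `T` induce a `K₄` in `G`. -/
  not_K4 : ∀ K : Finset V, G.IsNClique 4 K → ¬ ∀ t ∈ K.powersetCard 3, t ∈ T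
  /-- Every two-colouring of the edges of `G` has a monochromatic triangle in `T`. -/
  exists_mono : ∀ Δ : G.edgeSet → Fin 2, ∃ t ∈ T, IsMonochromatic Δ t

end QuasiFolkman

/-! ### The Hermitian unital and its secants

Here `F` is the field with `q ^ 2` elements; points of `PG(2, q²)` are elements of
`ℙ F (Fin 3 → F)`. -/

namespace HermitianUnital

variable (q : ℕ) (F : Type u) [Field F]

/-- The Hermitian unital: the points `⟨X, Y, Z⟩` with `X ^ (q+1) + Y ^ (q+1) + Z ^ (q+1) = 0`.
(The equation is homogeneous, so it holds for one generator of the one-dimensional subspace if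
and only if it holds for all its vectors.) -/
def unital : Set (ℙ F (Fin 3 → F)) :=
  {p | ∀ x ∈ p.submodule, x 0 ^ (q + 1) + x 1 ^ (q + 1) + x 2 ^ (q + 1) = 0}

/-- The secants: the lines of the projective plane (projective subspaces coming from
two-dimensional linear subspaces) that meet the unital in exactly `q + 1` points. -/
def secants : Set (Projectivization.Subspace F (Fin 3 → F)) :=
  {ℓ | Module.finrank F (Projectivization.Subspace.submodule ℓ) = 2 ∧
    ((ℓ : Set (ℙ F (Fin 3 → F))) ∩ unital q F).ncard = q + 1}

/-- The intersection graph `H_q`: its vertices are the secants, and two different secants are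
adjacent if and only if they intersect in a point of the unital. -/
def graph : SimpleGraph (secants q F) where
  Adj ℓ₁ ℓ₂ := ℓ₁ ≠ ℓ₂ ∧ ∃ p ∈ unital q F, p ∈ ℓ₁.1 ∧ p ∈ ℓ₂.1
  symm := ⟨fun _ _ h => ⟨h.1.symm, h.2.imp fun _ hp => ⟨hp.1, hp.2.2, hp.2.1⟩⟩⟩
  loopless := ⟨fun _ h => h.1 rfl⟩

/-- The set `𝒯_q` of non-degenerate triangles of `H_q`: triples of pairwise different secants
whose pairwise intersection points lie in the unital and are all distinct.  (Two different lines
have exactly one common point.) -/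
def nondegenerateTriangles : Set (Finset (secants q F)) :=
  {t | ∃ ℓ₁ ℓ₂ ℓ₃ : secants q F, (t : Set (secants q F)) = {ℓ₁, ℓ₂, ℓ₃} ∧
    ℓ₁ ≠ ℓ₂ ∧ ℓ₁ ≠ ℓ₃ ∧ ℓ₂ ≠ ℓ₃ ∧
    ∃ p₁₂ ∈ unital q F, ∃ p₁₃ ∈ unital q F, ∃ p₂₃ ∈ unital q F,
      (p₁₂ ∈ ℓ₁.1 ∧ p₁₂ ∈ ℓ₂.1) ∧ (p₁₃ ∈ ℓ₁.1 ∧ p₁₃ ∈ ℓ₃.1) ∧ (p₂₃ ∈ ℓ₂.1 ∧ p₂₃ ∈ ℓ₃.1) ∧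
      p₁₂ ≠ p₁₃ ∧ p₁₂ ≠ p₂₃ ∧ p₁₃ ≠ p₂₃}

end HermitianUnital

namespace HermitianUnital

/-! The points of the unital and the secants form a linear space: there are `q ^ 3 + 1` points, two
of them lie on exactly one secant, and every secant has `q + 1` points. Double counting pairs of
points gives the number of secants, and a non-degenerate triangle of secants is the same thing as
three noncollinear points.

A `K₄` all of whose triangles are non-degenerate would be an O'Nan configuration: four lines, no
three concurrent, with all six intersection points in the unital. After rescaling, three of these
points have a Gram matrix that is skew-symmetric with zero diagonal, hence singular, although the
Hermitian form is non-degenerate (`not_isotropic_quadrilateral`, `no_onan`).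

The colouring bound holds in every linear space with lines of size `k` (`card_not_mono_le`). Fix a
point `x` off a line `ℓ`, and colour each point `y` of `ℓ` by the colour of the edge between `ℓ` and
the line `xy`. At most a fraction `k / (2 (k - 1))` of the pairs on `ℓ` get two colours. A triangle
that is not monochromatic is split in this sense at exactly two of its three vertices, so such
triangles make up at most a fraction `3 k / (4 (k - 1))`. With `k = q + 1` at least `1/4 - 3/(4q)`
of the triangles are monochromatic, which is positive for `q ≥ 4`. -/

lemma finite_of_card {q : ℕ} {F : Type u} (hq : 2 ≤ q) (hF : Nat.card F = q ^ 2) : Finite F :=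
  Nat.finite_of_card_ne_zero (by rw [hF]; positivity)

/-! ### Trace, norm and isotropic vectors over the field with `q ^ 2` elements -/

section FieldCounting

variable {q : ℕ} {F : Type u} [Field F]

/-- Since `q` is a power of the characteristic, `x ↦ x ^ q` is an iterated Frobenius, and applying
it twice gives `x ^ (q ^ 2) = x`. -/
lemma exists_involution (hq : IsPrimePow q) (hF : Nat.card F = q ^ 2) :
    ∃ σ : F →+* F, (∀ x, σ x = x ^ q) ∧ ∀ x, σ (σ x) = x := by
  have hq2 : 2 ≤ q := hq.two_le
  have := finite_of_card hq2 hF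
  have := Fintype.ofFinite F
  obtain ⟨p, k, hp, hk, rfl⟩ := (isPrimePow_nat_iff q).1 hq
  obtain ⟨p', hch⟩ := CharP.exists F
  obtain ⟨n, hp', hc⟩ := FiniteField.card F p'
  rw [← Nat.card_eq_fintype_card, hF, ← pow_mul] at hc
  have hpp : p = p' := (Nat.prime_dvd_prime_iff_eq hp hp').1
    (hp.dvd_of_dvd_pow (hc ▸ dvd_pow_self p (by positivity)))
  subst hpp
  have : Fact p.Prime := ⟨hp⟩
  refine ⟨iterateFrobenius F p k, fun x => iterateFrobenius_def p k x, fun x => ?_⟩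
  rw [iterateFrobenius_def, iterateFrobenius_def, ← pow_mul, ← sq, ← hF,
    Nat.card_eq_fintype_card, FiniteField.pow_card]

open Polynomial in
lemma ncard_roots_le (P : F[X]) (hP : P ≠ 0) : {x | P.eval x = 0}.ncard ≤ P.natDegree := by
  classical
  have : {x | P.eval x = 0} = (P.roots.toFinset : Set F) := by
    ext x; simp [hP]
  rw [this, Set.ncard_coe_finset]
  exact (Multiset.toFinset_card_le _).trans P.card_roots'

open Polynomial in
/-- The kernel of the trace map of a quadratic extension of finite fields. -/
lemma ncard_trace_zero (hq : IsPrimePow q) (hF : Nat.card F = q ^ 2) :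
    {x : F | x + x ^ q = 0}.ncard = q := by
  have hq2 : 2 ≤ q := hq.two_le
  have := finite_of_card hq2 hF
  obtain ⟨σ, hσ, hσσ⟩ := exists_involution hq hF
  let φ : F →+ F := AddMonoidHom.id F + σ.toAddMonoidHom
  have hφ : ∀ x, φ x = x + x ^ q := fun x => by simp [φ, hσ]
  have h1 : (φ.ker : Set F) = {x : F | x + x ^ q = 0} := by
    ext x; simp [AddMonoidHom.mem_ker, hφ]
  have hd1 : (X + X ^ q : F[X]).natDegree = q := by
    rw [natDegree_add_eq_right_of_natDegree_lt] <;> simp; omega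
  have hd2 : (X ^ q - X : F[X]).natDegree = q := by
    rw [natDegree_sub_eq_left_of_natDegree_lt] <;> simp; omega
  -- Kernel and range each consist of roots of a polynomial of degree `q`. Their orders multiply to
  -- `q ^ 2`, so both bounds are attained.
  have hk : Nat.card φ.ker ≤ q := by
    have := ncard_roots_le (X + X ^ q : F[X]) (by intro h; simp [h] at hd1; omega)
    rw [hd1] at this
    rw [← SetLike.coe_sort_coe, Nat.card_coe_set_eq, h1]
    simpa using this
  have hr : Nat.card φ.range ≤ q := by
    have := ncard_roots_le (X ^ q - X : F[X]) (by intro h; simp [h] at hd2; omega)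
    rw [hd2] at this
    rw [← SetLike.coe_sort_coe, Nat.card_coe_set_eq]
    refine (Set.ncard_le_ncard ?_ (Set.toFinite _)).trans this
    rintro _ ⟨x, rfl⟩
    simp only [Set.mem_ofPred_eq, eval_sub, eval_pow, eval_X]
    rw [← hσ, hφ, ← hσ, map_add, hσσ]; ring
  have hm := φ.ker.card_mul_index
  rw [AddSubgroup.index_ker, hF] at hm
  rw [← h1, ← Nat.card_coe_set_eq, SetLike.coe_sort_coe]
  nlinarith

/-- The fibres of the norm map of a quadratic extension of finite fields. -/
lemma ncard_norm_eq [DecidableEq F] (hq : IsPrimePow q) (hF : Nat.card F = q ^ 2) {s : F}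
    (hs : s ^ q = s) : {x : F | x ^ (q + 1) = s}.ncard = if s = 0 then 1 else q + 1 := by
  have hq2 : 2 ≤ q := hq.two_le
  have := finite_of_card hq2 hF
  have := Fintype.ofFinite F
  split_ifs with h0
  · have : {x : F | x ^ (q + 1) = s} = {0} := by
      ext x; simp [h0]
    rw [this, Set.ncard_singleton]
  let φ : Fˣ →* Fˣ := powMonoidHom (q + 1)
  have hcard : Nat.card Fˣ = (q + 1) * (q - 1) := by
    rw [Nat.card_units, hF]
    obtain ⟨r, rfl⟩ : ∃ r, q = r + 1 := ⟨q - 1, by omega⟩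
    simp; ring_nf; omega
  have hone : ∀ x : Fˣ, x ^ ((q + 1) * (q - 1)) = 1 := fun x => by
    rw [← hcard]; exact pow_card_eq_one'
  have : NeZero (q - 1) := ⟨by omega⟩
  have hker : φ.ker = rootsOfUnity (q + 1) F := by
    ext x; simp [φ, MonoidHom.mem_ker, mem_rootsOfUnity]
  -- The bounds `q + 1` for the kernel and `q - 1` for the range multiply to the order of `Fˣ`, so
  -- both are equalities. Hence every nonzero `s` fixed by `x ↦ x ^ q` is a norm, and its fibre is a
  -- coset of the kernel.
  have hk : Nat.card φ.ker ≤ q + 1 := by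
    rw [hker]; exact card_rootsOfUnity F (q + 1)
  have hrle : φ.range ≤ rootsOfUnity (q - 1) F := by
    rintro _ ⟨x, rfl⟩
    rw [mem_rootsOfUnity]
    simp only [φ, powMonoidHom_apply]
    rw [← pow_mul, hone]
  have hr' : Nat.card (rootsOfUnity (q - 1) F) ≤ q - 1 := card_rootsOfUnity F (q - 1)
  have hr : Nat.card φ.range ≤ Nat.card (rootsOfUnity (q - 1) F) :=
    Nat.card_le_card_of_injective _ (Subgroup.inclusion_injective hrle)
  have hm := φ.ker.card_mul_index
  rw [Subgroup.index_ker, hcard] at hm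
  have hpos : 0 < q - 1 := by omega
  have hk1 : Nat.card φ.ker = q + 1 := by
    refine le_antisymm hk (Nat.le_of_mul_le_mul_right ?_ hpos)
    rw [← hm]; exact Nat.mul_le_mul_left _ (hr.trans hr')
  have hr1 : Nat.card φ.range = q - 1 := by
    rw [hk1] at hm; exact Nat.eq_of_mul_eq_mul_left (by omega) hm
  have hreq : φ.range = rootsOfUnity (q - 1) F :=
    Subgroup.eq_of_le_of_card_ge hrle (by omega)
  have hmem : Units.mk0 s h0 ∈ φ.range := by
    rw [hreq, mem_rootsOfUnity]
    ext
    simp only [Units.val_pow_eq_pow_val, Units.val_mk0, Units.val_one]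
    apply mul_right_cancel₀ h0
    rw [← pow_succ, Nat.sub_add_cancel (by omega), hs, one_mul]
  obtain ⟨y, hy⟩ := hmem
  have hy' : (y : F) ^ (q + 1) = s := by
    have := congrArg Units.val hy
    simpa [φ] using this
  rw [← Nat.card_coe_set_eq]
  refine Eq.trans (Eq.symm ?_) hk1
  refine Nat.card_congr (Equiv.ofBijective
    (fun u : φ.ker => ⟨((u : Fˣ) : F) * y, ?_⟩) ⟨?_, ?_⟩)
  · have := congrArg Units.val (MonoidHom.mem_ker.1 u.2)
    simp only [φ, powMonoidHom_apply, Units.val_pow_eq_pow_val, Units.val_one] at this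
    simp [mul_pow, this, hy']
  · intro u u' h
    ext
    simpa using h
  · rintro ⟨x, hx⟩
    have hx0 : x ≠ 0 := by rintro rfl; exact h0 (by simpa using hx.symm)
    refine ⟨⟨Units.mk0 x hx0 * y⁻¹, ?_⟩, by simp⟩
    rw [MonoidHom.mem_ker]
    ext
    simp only [Set.mem_ofPred_eq] at hx
    simp [φ, mul_pow, hx, hy', h0]

/-- For given `x` and `y`, the last coordinate has a prescribed norm; this allows `q + 1` choices,
or a single one if that norm is zero. Pairs with norm zero are counted the same way. -/
lemma card_isotropic (hq : IsPrimePow q) (hF : Nat.card F = q ^ 2) :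
    {x : Fin 3 → F | x 0 ^ (q + 1) + x 1 ^ (q + 1) + x 2 ^ (q + 1) = 0}.ncard =
      (q ^ 3 + 1) * (q ^ 2 - 1) + 1 := by
  classical
  have hq2 : 2 ≤ q := hq.two_le
  have := finite_of_card hq2 hF
  have := Fintype.ofFinite F
  obtain ⟨σ, hσ, hσσ⟩ := exists_involution hq hF
  have hfix : ∀ x : F, (x ^ (q + 1)) ^ q = x ^ (q + 1) := fun x => by
    rw [← hσ, pow_succ, map_mul, ← hσ, hσσ, mul_comm]
  have hfibre : ∀ s : F, s ^ q = s →
      (Finset.univ.filter fun x : F => x ^ (q + 1) = s).card = if s = 0 then 1 else q + 1 := by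
    intro s hs
    rw [← ncard_norm_eq hq hF hs, ← Set.ncard_coe_finset]
    congr 1; ext; simp
  have hFc : Fintype.card F = q ^ 2 := by rw [← hF, Nat.card_eq_fintype_card]
  have h2 : ∑ x : F, ∑ y : F, (if y ^ (q + 1) = -(x ^ (q + 1)) then 1 else 0) =
      1 + (q ^ 2 - 1) * (q + 1) := by
    have : ∀ x : F, ∑ y : F, (if y ^ (q + 1) = -(x ^ (q + 1)) then 1 else 0) =
        if x = 0 then 1 else q + 1 := by
      intro x
      rw [← Finset.card_filter, hfibre]
      · simp
      · rw [← hσ, map_neg, hσ, hfix]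
    rw [Finset.sum_congr rfl fun x _ => this x, Finset.sum_ite, Finset.sum_const, Finset.sum_const,
      Finset.filter_eq' Finset.univ (0 : F), Finset.filter_ne' Finset.univ (0 : F)]
    simp [hFc]
  have h3 : {x : Fin 3 → F | x 0 ^ (q + 1) + x 1 ^ (q + 1) + x 2 ^ (q + 1) = 0}.ncard =
      ∑ x : F, ∑ y : F, ∑ z : F,
        (if z ^ (q + 1) = -(x ^ (q + 1) + y ^ (q + 1)) then 1 else 0) := by
    simp_rw [← Fintype.sum_prod_type', ← Finset.card_filter]
    rw [← Set.ncard_coe_finset]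
    refine Set.ncard_congr (fun x _ => (x 0, x 1, x 2)) ?_ ?_ ?_
    · intro x hx
      simp only [Set.mem_ofPred_eq] at hx
      simp only [Finset.coe_filter, Finset.mem_univ, true_and, Set.mem_ofPred_eq]
      linear_combination hx
    · intro x y _ _ h
      simp only [Prod.mk.injEq] at h
      ext i; fin_cases i
      exacts [h.1, h.2.1, h.2.2]
    · rintro ⟨a, b, c⟩ h
      simp only [Finset.coe_filter, Finset.mem_univ, true_and, Set.mem_ofPred_eq] at h
      refine ⟨![a, b, c], ?_, by simp⟩
      simp only [Set.mem_ofPred_eq, Matrix.cons_val_zero, Matrix.cons_val_one, Matrix.cons_val]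
      linear_combination h
  -- The term with factor `q` makes up for the fibre over zero, which has `1` element instead of `q
  -- + 1`.
  have h4 : ∀ x y : F, (∑ z : F, (if z ^ (q + 1) = -(x ^ (q + 1) + y ^ (q + 1)) then 1 else 0)) +
      q * (if y ^ (q + 1) = -(x ^ (q + 1)) then 1 else 0) = q + 1 := by
    intro x y
    rw [← Finset.card_filter, hfibre]
    · have : -(x ^ (q + 1) + y ^ (q + 1)) = 0 ↔ y ^ (q + 1) = -(x ^ (q + 1)) := by
        rw [neg_eq_zero, add_comm, add_eq_zero_iff_eq_neg]
      simp only [this]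
      split_ifs <;> omega
    · rw [← hσ, map_neg, map_add, hσ, hσ, hfix, hfix]
  have h5 : (∑ x : F, ∑ y : F, ∑ z : F,
        (if z ^ (q + 1) = -(x ^ (q + 1) + y ^ (q + 1)) then 1 else 0)) +
      q * (1 + (q ^ 2 - 1) * (q + 1)) = q ^ 2 * (q ^ 2 * (q + 1)) := by
    rw [← h2, Finset.mul_sum, ← Finset.sum_add_distrib]
    have : ∀ x : F, (∑ y : F, ∑ z : F,
        (if z ^ (q + 1) = -(x ^ (q + 1) + y ^ (q + 1)) then 1 else 0)) +
        q * ∑ y : F, (if y ^ (q + 1) = -(x ^ (q + 1)) then 1 else 0) = q ^ 2 * (q + 1) := by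
      intro x
      rw [Finset.mul_sum, ← Finset.sum_add_distrib, Finset.sum_congr rfl fun y _ => h4 x y]
      simp [hFc]
    rw [Finset.sum_congr rfl fun x _ => this x]
    simp [hFc]
  rw [h3]
  have h1q : 1 ≤ q ^ 2 := by nlinarith
  zify [h1q] at h5 ⊢
  linear_combination h5

end FieldCounting

end HermitianUnital

namespace HermitianUnital

/-! ### The Hermitian form and isotropic vectors -/

section HermitianForm

variable {F : Type u} [Field F] (σ : F →+* F)

/-- The standard `σ`-sesquilinear form on `F ^ 3`. -/
def hermForm (x y : Fin 3 → F) : F := x 0 * σ (y 0) + x 1 * σ (y 1) + x 2 * σ (y 2)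

variable {σ}

lemma hermForm_add_left (x y z : Fin 3 → F) :
    hermForm σ (x + y) z = hermForm σ x z + hermForm σ y z := by
  simp only [hermForm, Pi.add_apply]; ring

lemma hermForm_add_right (x y z : Fin 3 → F) :
    hermForm σ x (y + z) = hermForm σ x y + hermForm σ x z := by
  simp only [hermForm, Pi.add_apply, map_add]; ring

lemma hermForm_sub_left (x y z : Fin 3 → F) :
    hermForm σ (x - y) z = hermForm σ x z - hermForm σ y z := by
  simp only [hermForm, Pi.sub_apply]; ring

lemma hermForm_sub_right (x y z : Fin 3 → F) :
    hermForm σ x (y - z) = hermForm σ x y - hermForm σ x z := by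
  simp only [hermForm, Pi.sub_apply, map_sub]; ring

lemma hermForm_smul_left (a : F) (x y : Fin 3 → F) :
    hermForm σ (a • x) y = a * hermForm σ x y := by
  simp only [hermForm, Pi.smul_apply, smul_eq_mul]; ring

lemma hermForm_smul_right (a : F) (x y : Fin 3 → F) :
    hermForm σ x (a • y) = σ a * hermForm σ x y := by
  simp only [hermForm, Pi.smul_apply, smul_eq_mul, map_mul]; ring

lemma map_hermForm (hσ : ∀ x, σ (σ x) = x) (x y : Fin 3 → F) :
    σ (hermForm σ x y) = hermForm σ y x := by
  simp only [hermForm, map_add, map_mul, hσ]; ring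

lemma eq_zero_of_hermForm_eq_zero {n : Fin 3 → F} (h : ∀ y, hermForm σ n y = 0) : n = 0 := by
  ext i
  have := h (Pi.single i 1)
  fin_cases i <;> simpa [hermForm] using this

/-- A vector orthogonal to a plane and to a vector outside it vanishes. -/
lemma eq_zero_of_orthogonal {W : Submodule F (Fin 3 → F)} (hW : Module.finrank F W = 2)
    {z n : Fin 3 → F} (hz : z ∉ W) (hnW : ∀ y ∈ W, hermForm σ n y = 0)
    (hnz : hermForm σ n z = 0) : n = 0 := by
  have hlt : W < W ⊔ Submodule.span F {z} := by
    refine lt_of_le_of_ne le_sup_left fun h => hz ?_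
    rw [h]
    exact Submodule.mem_sup_right (Submodule.mem_span_singleton_self z)
  have htop : W ⊔ Submodule.span F {z} = ⊤ := by
    apply Submodule.eq_top_of_finrank_eq
    have h1 := Submodule.finrank_lt_finrank_of_lt hlt
    have h2 := Submodule.finrank_le (W ⊔ Submodule.span F {z})
    simp only [Module.finrank_fin_fun] at h2 ⊢
    omega
  refine eq_zero_of_hermForm_eq_zero (σ := σ) fun y => ?_
  have hy : y ∈ W ⊔ Submodule.span F {z} := htop ▸ Submodule.mem_top
  obtain ⟨w, hw, t, ht, rfl⟩ := Submodule.mem_sup.1 hy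
  obtain ⟨a, rfl⟩ := Submodule.mem_span_singleton.1 ht
  rw [hermForm_add_right, hermForm_smul_right, hnW w hw, hnz]; ring

lemma finrank_span_pair {x y : Fin 3 → F} (h : LinearIndependent F ![x, y]) :
    Module.finrank F (Submodule.span F {x, y}) = 2 := by
  have := finrank_span_eq_card h
  rwa [Matrix.range_cons, Matrix.range_cons, Matrix.range_empty, Set.union_empty,
    Set.singleton_union, Fintype.card_fin] at this

/-- There are no totally isotropic lines. -/
lemma hermForm_ne_zero (hσ : ∀ x, σ (σ x) = x) {x y : Fin 3 → F}
    (h : LinearIndependent F ![x, y])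
    (hx : hermForm σ x x = 0) (hy : hermForm σ y y = 0) : hermForm σ x y ≠ 0 := by
  intro hxy
  have hyx : hermForm σ y x = 0 := by rw [← map_hermForm hσ, hxy, map_zero]
  have hW := finrank_span_pair h
  obtain ⟨z, hz⟩ : ∃ z, z ∉ Submodule.span F {x, y} := by
    by_contra! hall
    have : Submodule.span F {x, y} = ⊤ := by
      rw [eq_top_iff]; intro z _; exact hall z
    rw [this] at hW
    simp at hW
  have hx0 : x ≠ 0 := h.ne_zero 0
  have hy0 : y ≠ 0 := h.ne_zero 1
  have horth : ∀ a b : F, ∀ w ∈ Submodule.span F {x, y}, hermForm σ (a • x + b • y) w = 0 := by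
    intro a b w hw
    obtain ⟨c, d, rfl⟩ := Submodule.mem_span_pair.1 hw
    simp only [hermForm_add_left, hermForm_add_right, hermForm_smul_left, hermForm_smul_right,
      hx, hy, hxy, hyx]
    ring
  -- The coefficients make this vector of the totally isotropic plane orthogonal to `z` as well, so
  -- it vanishes. By independence `x` is then orthogonal to `z`, hence to everything.
  have h0 : hermForm σ y z • x + (-hermForm σ x z) • y = 0 := by
    refine eq_zero_of_orthogonal hW hz (horth _ _) ?_
    rw [hermForm_add_left, hermForm_smul_left, hermForm_smul_left]; ring
  have h1 := LinearIndependent.pair_iff.1 h _ _ h0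
  refine hx0 (eq_zero_of_orthogonal (σ := σ) hW hz ?_ (neg_eq_zero.1 h1.2))
  intro w hw
  simpa using horth 1 0 w hw

/-- The algebraic core of the absence of O'Nan configurations: if `u`, `v`, `w`, `u + v`, `u + w`
and `v - w` are isotropic then `u`, `v`, `w` are dependent. -/
lemma not_isotropic_quadrilateral (hσ : ∀ x, σ (σ x) = x) {u v w : Fin 3 → F}
    (huv : LinearIndependent F ![u, v]) (hw : w ∉ Submodule.span F {u, v})
    (hu : hermForm σ u u = 0) (hv : hermForm σ v v = 0) (hww : hermForm σ w w = 0)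
    (h1 : hermForm σ (u + v) (u + v) = 0) (h2 : hermForm σ (u + w) (u + w) = 0)
    (h3 : hermForm σ (v - w) (v - w) = 0) : False := by
  simp only [hermForm_add_left, hermForm_add_right, hermForm_sub_left, hermForm_sub_right,
    hu, hv, hww] at h1 h2 h3
  have hne := hermForm_ne_zero hσ huv hu hv
  -- By `h1`, `h2`, `h3` the Gram matrix of `u, v, w` is skew-symmetric with zero diagonal. These
  -- coefficients are its standard kernel vector, so the combination lies in the radical of the
  -- form.
  have hn : hermForm σ v w • u + (-hermForm σ u w) • v + hermForm σ u v • w = 0 := by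
    refine eq_zero_of_orthogonal (σ := σ) (finrank_span_pair huv) hw ?_ ?_
    · intro y hy
      obtain ⟨c, d, rfl⟩ := Submodule.mem_span_pair.1 hy
      simp only [hermForm_add_left, hermForm_add_right, hermForm_smul_left, hermForm_smul_right,
        hu, hv]
      linear_combination (-σ c * hermForm σ u w) * h1 + σ c * hermForm σ u v * h2
        - σ d * hermForm σ u v * h3
    · simp only [hermForm_add_left, hermForm_smul_left, hww]; ring
  apply hw
  rw [Submodule.mem_span_pair]
  refine ⟨-(hermForm σ u v)⁻¹ * hermForm σ v w, (hermForm σ u v)⁻¹ * hermForm σ u w, ?_⟩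
  have h4 := congrArg (fun x => (hermForm σ u v)⁻¹ • x) hn
  simp only [smul_add, smul_smul, inv_mul_cancel₀ hne, one_smul, smul_zero] at h4
  rw [← sub_eq_zero, ← neg_eq_zero, ← h4]
  module

end HermitianForm

/-! ### Points and secants of the unital -/

section Unital

variable {q : ℕ} {F : Type u} [Field F] {σ : F →+* F}

lemma hermForm_self (hσ : ∀ x, σ x = x ^ q) (x : Fin 3 → F) :
    hermForm σ x x = x 0 ^ (q + 1) + x 1 ^ (q + 1) + x 2 ^ (q + 1) := by
  simp only [hermForm, hσ]; ring

lemma mk_mem_unital (hσ : ∀ x, σ x = x ^ q) {x : Fin 3 → F} (hx : x ≠ 0) :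
    Projectivization.mk F x hx ∈ unital q F ↔ hermForm σ x x = 0 := by
  simp only [unital, Set.mem_ofPred_eq, ← hermForm_self hσ, Projectivization.submodule_mk]
  constructor
  · exact fun h => h x (Submodule.mem_span_singleton_self x)
  · intro h y hy
    obtain ⟨a, rfl⟩ := Submodule.mem_span_singleton.1 hy
    rw [hermForm_smul_left, hermForm_smul_right, h]; ring

lemma mem_unital (hσ : ∀ x, σ x = x ^ q) (p : ℙ F (Fin 3 → F)) :
    p ∈ unital q F ↔ hermForm σ p.rep p.rep = 0 := by
  rw [← mk_mem_unital hσ p.rep_nonzero, Projectivization.mk_rep]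

lemma mem_iff_rep_mem (ℓ : Projectivization.Subspace F (Fin 3 → F)) (p : ℙ F (Fin 3 → F)) :
    p ∈ ℓ ↔ p.rep ∈ Projectivization.Subspace.submodule ℓ := by
  rw [Projectivization.Subspace.mem_submodule_iff _ p.rep_nonzero, Projectivization.mk_rep]

lemma linearIndependent_rep {p p' : ℙ F (Fin 3 → F)} (h : p ≠ p') :
    LinearIndependent F ![p.rep, p'.rep] :=
  Projectivization.linearIndependent_pair_iff_ne.2 h

lemma submodule_eq_span {ℓ : Projectivization.Subspace F (Fin 3 → F)}
    (hℓ : Module.finrank F (Projectivization.Subspace.submodule ℓ) = 2)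
    {p p' : ℙ F (Fin 3 → F)} (h : p ≠ p') (hp : p ∈ ℓ) (hp' : p' ∈ ℓ) :
    Projectivization.Subspace.submodule ℓ = Submodule.span F {p.rep, p'.rep} := by
  symm
  apply Submodule.eq_of_le_of_finrank_eq
  · rw [Submodule.span_le]
    rintro x (rfl | rfl)
    exacts [(mem_iff_rep_mem _ _).1 hp, (mem_iff_rep_mem _ _).1 hp']
  · rw [hℓ, finrank_span_pair (linearIndependent_rep h)]

lemma line_unique {ℓ ℓ' : Projectivization.Subspace F (Fin 3 → F)}
    (hℓ : Module.finrank F (Projectivization.Subspace.submodule ℓ) = 2)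
    (hℓ' : Module.finrank F (Projectivization.Subspace.submodule ℓ') = 2)
    {p p' : ℙ F (Fin 3 → F)} (h : p ≠ p') (hp : p ∈ ℓ) (hp' : p' ∈ ℓ)
    (hq : p ∈ ℓ') (hq' : p' ∈ ℓ') : ℓ = ℓ' := by
  apply Projectivization.Subspace.submodule.injective
  rw [submodule_eq_span hℓ h hp hp', submodule_eq_span hℓ' h hq hq']

/-- A line with two points in the unital meets it in `q + 1` points. -/
lemma ncard_inter_unital (hq : IsPrimePow q) (hF : Nat.card F = q ^ 2)
    {ℓ : Projectivization.Subspace F (Fin 3 → F)}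
    (hℓ : Module.finrank F (Projectivization.Subspace.submodule ℓ) = 2)
    {p p' : ℙ F (Fin 3 → F)} (h : p ≠ p') (hp : p ∈ ℓ) (hp' : p' ∈ ℓ)
    (hpu : p ∈ unital q F) (hpu' : p' ∈ unital q F) :
    ((ℓ : Set (ℙ F (Fin 3 → F))) ∩ unital q F).ncard = q + 1 := by
  have := finite_of_card hq.two_le hF
  obtain ⟨σ, hσ, hσσ⟩ := exists_involution hq hF
  have hli := linearIndependent_rep h
  have hspan := submodule_eq_span hℓ h hp hp'
  rw [mem_unital hσ] at hpu hpu'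
  have hc := hermForm_ne_zero hσσ hli hpu hpu'
  have hp'0 := p'.rep_nonzero
  set x := p.rep with hx
  set y := p'.rep with hy
  have hyx : hermForm σ y x = σ (hermForm σ x y) := (map_hermForm hσσ x y).symm
  set c := hermForm σ x y with hcdef
  have hσc : σ c ≠ 0 := by rwa [Ne, map_eq_zero]
  have hne : ∀ t : F, x + t • y ≠ 0 := fun t ht => by
    have := (LinearIndependent.pair_iff.1 hli 1 t (by rwa [one_smul])).1
    exact one_ne_zero this
  have hform : ∀ t : F, hermForm σ (x + t • y) (x + t • y) = 0 ↔ t * σ c + (t * σ c) ^ q = 0 := by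
    intro t
    simp only [hermForm_add_left, hermForm_add_right, hermForm_smul_left, hermForm_smul_right,
      hpu, hpu', hyx, ← hcdef]
    rw [← hσ, map_mul, hσσ]
    ring_nf
  -- Apart from `p'`, a point of the line is `x + t • y`, and it is isotropic exactly when `t * σ c`
  -- has trace zero. This gives `1 + q` points.
  have hset : (ℓ : Set (ℙ F (Fin 3 → F))) ∩ unital q F =
      insert p' ((fun s : F => Projectivization.mk F _ (hne (s * (σ c)⁻¹))) ''
        {s : F | s + s ^ q = 0}) := by
    ext r
    simp only [Set.mem_inter_iff, SetLike.mem_coe, Set.mem_insert_iff, Set.mem_image,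
      Set.mem_ofPred_eq]
    constructor
    · rintro ⟨hrℓ, hru⟩
      rw [mem_iff_rep_mem, hspan, Submodule.mem_span_pair] at hrℓ
      obtain ⟨a, b, hab⟩ := hrℓ
      by_cases ha : a = 0
      · left
        rw [← r.mk_rep, ← p'.mk_rep, Projectivization.mk_eq_mk_iff']
        exact ⟨b, by rw [← hab, ha, zero_smul, zero_add]⟩
      · right
        have hr : r = Projectivization.mk F _ (hne (a⁻¹ * b)) := by
          conv_lhs => rw [← r.mk_rep]
          rw [Projectivization.mk_eq_mk_iff']
          refine ⟨a, ?_⟩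
          rw [← hab, smul_add, smul_smul, mul_inv_cancel_left₀ ha]
        rw [hr, mk_mem_unital hσ, hform] at hru
        refine ⟨a⁻¹ * b * σ c, hru, ?_⟩
        rw [hr]
        simp only [mul_inv_cancel_right₀ hσc]
    · rintro (rfl | ⟨s, hs, rfl⟩)
      · exact ⟨hp', (mem_unital hσ _).2 hpu'⟩
      · rw [mk_mem_unital hσ, hform, inv_mul_cancel_right₀ hσc]
        refine ⟨?_, hs⟩
        rw [← Projectivization.Subspace.mem_submodule_iff, hspan, Submodule.mem_span_pair]
        exact ⟨1, s * (σ c)⁻¹, by rw [one_smul]⟩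
  rw [hset, Set.ncard_insert_of_notMem, Set.ncard_image_of_injective, ncard_trace_zero hq hF]
  · intro s s' hss
    simp only [Projectivization.mk_eq_mk_iff'] at hss
    obtain ⟨a, ha⟩ := hss
    have := LinearIndependent.pair_iff.1 hli (a - 1) (a * (s' * (σ c)⁻¹) - s * (σ c)⁻¹) (by
      rw [← sub_eq_zero] at ha
      rw [← ha]; module)
    have ha1 : a = 1 := by linear_combination this.1
    have h2 := this.2
    rw [ha1, one_mul, sub_eq_zero] at h2
    exact (mul_right_cancel₀ (inv_ne_zero hσc) h2).symm
  · rintro ⟨s, -, hs⟩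
    rw [← p'.mk_rep, Projectivization.mk_eq_mk_iff'] at hs
    obtain ⟨a, ha⟩ := hs
    have := LinearIndependent.pair_iff.1 hli 1 (s * (σ c)⁻¹ - a) (by
      rw [← sub_eq_zero] at ha
      rw [← neg_eq_zero, ← ha]; module)
    exact one_ne_zero this.1

/-- Two points of the unital lie on a common secant. -/
lemma exists_secant (hq : IsPrimePow q) (hF : Nat.card F = q ^ 2)
    {p p' : ℙ F (Fin 3 → F)} (h : p ≠ p') (hpu : p ∈ unital q F) (hpu' : p' ∈ unital q F) :
    ∃ ℓ : secants q F, p ∈ ℓ.1 ∧ p' ∈ ℓ.1 := by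
  let ℓ := Projectivization.Subspace.submodule.symm (Submodule.span F {p.rep, p'.rep})
  have hsub : Projectivization.Subspace.submodule ℓ = Submodule.span F {p.rep, p'.rep} :=
    OrderIso.apply_symm_apply _ _
  have hℓ : Module.finrank F (Projectivization.Subspace.submodule ℓ) = 2 := by
    rw [hsub, finrank_span_pair (linearIndependent_rep h)]
  have hp : p ∈ ℓ := by
    rw [mem_iff_rep_mem, hsub]; exact Submodule.subset_span (by simp)
  have hp' : p' ∈ ℓ := by
    rw [mem_iff_rep_mem, hsub]; exact Submodule.subset_span (by simp)
  exact ⟨⟨ℓ, hℓ, ncard_inter_unital hq hF hℓ h hp hp' hpu hpu'⟩, hp, hp'⟩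

lemma secant_unique {ℓ ℓ' : secants q F} {p p' : ℙ F (Fin 3 → F)} (h : p ≠ p') (hp : p ∈ ℓ.1)
    (hp' : p' ∈ ℓ.1) (hq : p ∈ ℓ'.1) (hq' : p' ∈ ℓ'.1) : ℓ = ℓ' :=
  Subtype.ext (line_unique ℓ.2.1 ℓ'.2.1 h hp hp' hq hq')

/-- Every point of the unital is spanned by exactly `q ^ 2 - 1` nonzero isotropic vectors, so the
count follows from `card_isotropic`. -/
lemma ncard_unital (hq : IsPrimePow q) (hF : Nat.card F = q ^ 2) :
    (unital q F).ncard = q ^ 3 + 1 := by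
  have hq2 := hq.two_le
  have := finite_of_card hq2 hF
  obtain ⟨σ, hσ, -⟩ := exists_involution hq hF
  have hiso := card_isotropic hq hF
  set S := {x : Fin 3 → F | x 0 ^ (q + 1) + x 1 ^ (q + 1) + x 2 ^ (q + 1) = 0} with hS
  have hS' : ∀ x, x ∈ S ↔ hermForm σ x x = 0 := fun x => by rw [hermForm_self hσ]; rfl
  have h0 : (0 : Fin 3 → F) ∈ S := by simp [hS]
  have hdiff : (S \ {0}).ncard = (q ^ 3 + 1) * (q ^ 2 - 1) := by
    rw [Set.ncard_sdiff_singleton_of_mem h0, hiso]; rfl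
  have hprod : Nat.card (unital q F × Fˣ) = (S \ {0}).ncard := by
    rw [← Nat.card_coe_set_eq]
    refine Nat.card_congr (Equiv.ofBijective
      (fun x => ⟨(x.2 : F) • x.1.1.rep, ?_, ?_⟩) ⟨?_, ?_⟩)
    · rw [hS', hermForm_smul_left, hermForm_smul_right, (mem_unital hσ _).1 x.1.2]; ring
    · simpa using x.1.1.rep_nonzero
    · rintro ⟨p, a⟩ ⟨p', a'⟩ h
      have h : (a : F) • p.1.rep = (a' : F) • p'.1.rep := congrArg Subtype.val h
      have hp : p = p' := by
        ext1
        rw [← p.1.mk_rep, ← p'.1.mk_rep, Projectivization.mk_eq_mk_iff]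
        exact ⟨a⁻¹ * a', by rw [mul_smul, Units.smul_def a', ← h, Units.smul_def, smul_smul]; simp⟩
      subst hp
      have := smul_left_injective F p.1.rep_nonzero h
      rw [Units.ext this]
    · rintro ⟨x, hx, hx0⟩
      have hx0 : x ≠ 0 := hx0
      obtain ⟨a, ha⟩ := Projectivization.exists_smul_eq_mk_rep F x hx0
      refine ⟨⟨⟨Projectivization.mk F x hx0, (mk_mem_unital hσ hx0).2 ((hS' x).1 hx)⟩, a⁻¹⟩, ?_⟩
      apply Subtype.ext
      change a⁻¹ • (Projectivization.mk F x hx0).rep = x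
      rw [← ha, inv_smul_smul]
  rw [Nat.card_prod, Nat.card_units, hF, hdiff, Nat.card_coe_set_eq] at hprod
  refine Nat.eq_of_mul_eq_mul_right ?_ hprod
  have : 4 ≤ q ^ 2 := by nlinarith
  omega

/-- The unital contains no O'Nan configuration. -/
lemma no_onan (hq : IsPrimePow q) (hF : Nat.card F = q ^ 2) {A B C D : secants q F}
    {pab pac pbc pad pbd pcd : ℙ F (Fin 3 → F)}
    (hab : pab ∈ unital q F) (hac : pac ∈ unital q F) (hbc : pbc ∈ unital q F)
    (had : pad ∈ unital q F) (hbd : pbd ∈ unital q F) (hcd : pcd ∈ unital q F)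
    (habA : pab ∈ A.1) (habB : pab ∈ B.1) (hacA : pac ∈ A.1) (hacC : pac ∈ C.1)
    (hbcB : pbc ∈ B.1) (hbcC : pbc ∈ C.1) (hadA : pad ∈ A.1) (hadD : pad ∈ D.1)
    (hbdB : pbd ∈ B.1) (hbdD : pbd ∈ D.1) (hcdC : pcd ∈ C.1) (hcdD : pcd ∈ D.1)
    (hCD : C ≠ D)
    (hABC : ∀ p, p ∈ A.1 → p ∈ B.1 → p ∉ C.1) (hABD : ∀ p, p ∈ A.1 → p ∈ B.1 → p ∉ D.1)
    (hACD : ∀ p, p ∈ A.1 → p ∈ C.1 → p ∉ D.1) (hBCD : ∀ p, p ∈ B.1 → p ∈ C.1 → p ∉ D.1) :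
    False := by
  obtain ⟨σ, hσ, hσσ⟩ := exists_involution hq hF
  have h1 : pab ≠ pac := by rintro rfl; exact hABC _ habA habB hacC
  have h2 : pab ≠ pbc := by rintro rfl; exact hABC _ habA habB hbcC
  have h3 : pac ≠ pbc := by rintro rfl; exact hABC _ hacA hbcB hacC
  have hA := submodule_eq_span A.2.1 h1 habA hacA
  have hB := submodule_eq_span B.2.1 h2 habB hbcB
  have hC := submodule_eq_span C.2.1 h3 hacC hbcC
  have hwA : pbc.rep ∉ Submodule.span F {pab.rep, pac.rep} := by
    rw [← hA, ← mem_iff_rep_mem]; exact fun h => hABC _ h hbcB hbcC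
  have hli := linearIndependent_rep h1
  have hlivw := linearIndependent_rep h3
  have had' := hadA
  have hbd' := hbdB
  rw [mem_iff_rep_mem, hA, Submodule.mem_span_pair] at had'
  rw [mem_iff_rep_mem, hB, Submodule.mem_span_pair] at hbd'
  obtain ⟨a, b, hadr⟩ := had'
  obtain ⟨c, d, hbdr⟩ := hbd'
  have key : ∀ {r p : ℙ F (Fin 3 → F)} {t : F}, t • p.rep = r.rep → r = p := by
    intro r p t h
    rw [← r.mk_rep, ← p.mk_rep, Projectivization.mk_eq_mk_iff']
    exact ⟨t, h⟩
  -- If one of the four coefficients vanished, `D` would pass through a vertex of the triangle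
  -- `ABC`, making three of the lines concurrent.
  have ha : a ≠ 0 := by
    rintro rfl
    rw [zero_smul, zero_add] at hadr
    exact hACD pac hacA hacC (key hadr ▸ hadD)
  have hb : b ≠ 0 := by
    rintro rfl
    rw [zero_smul, add_zero] at hadr
    exact hABD pab habA habB (key hadr ▸ hadD)
  have hc : c ≠ 0 := by
    rintro rfl
    rw [zero_smul, zero_add] at hbdr
    exact hBCD pbc hbcB hbcC (key hbdr ▸ hbdD)
  have hd : d ≠ 0 := by
    rintro rfl
    rw [zero_smul, add_zero] at hbdr
    exact hABD pab habA habB (key hbdr ▸ hbdD)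
  set u := pab.rep
  set v := pac.rep
  set w := pbc.rep
  -- After this rescaling `u + v'` and `u + w'` represent the points of `D` on `A` and `B`. Their
  -- difference `v' - w'` lies on both `C` and `D`, so it represents `pcd`.
  set v' := (a⁻¹ * b) • v with hv'
  set w' := (c⁻¹ * d) • w with hw'
  have hvc : a⁻¹ * b ≠ 0 := mul_ne_zero (inv_ne_zero ha) hb
  have hwc : c⁻¹ * d ≠ 0 := mul_ne_zero (inv_ne_zero hc) hd
  have had1 : u + v' = a⁻¹ • pad.rep := by
    rw [← hadr, smul_add, smul_smul, smul_smul, inv_mul_cancel₀ ha, one_smul]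
  have hbd1 : u + w' = c⁻¹ • pbd.rep := by
    rw [← hbdr, smul_add, smul_smul, smul_smul, inv_mul_cancel₀ hc, one_smul]
  have hiso : ∀ (t : F) {p : ℙ F (Fin 3 → F)}, p ∈ unital q F →
      hermForm σ (t • p.rep) (t • p.rep) = 0 := by
    intro t p hp
    rw [hermForm_smul_left, hermForm_smul_right, (mem_unital hσ _).1 hp]; ring
  have hne : v' - w' ≠ 0 := by
    intro h
    have := LinearIndependent.pair_iff.1 hlivw (a⁻¹ * b) (-(c⁻¹ * d)) (by
      rw [← h]; simp only [hv', hw']; module)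
    exact hvc this.1
  have hsC : v' - w' ∈ Projectivization.Subspace.submodule C.1 :=
    Submodule.sub_mem _ (Submodule.smul_mem _ _ ((mem_iff_rep_mem _ _).1 hacC))
      (Submodule.smul_mem _ _ ((mem_iff_rep_mem _ _).1 hbcC))
  have hsD : v' - w' ∈ Projectivization.Subspace.submodule D.1 := by
    have : v' - w' = a⁻¹ • pad.rep - c⁻¹ • pbd.rep := by rw [← had1, ← hbd1]; abel
    rw [this]
    exact Submodule.sub_mem _ (Submodule.smul_mem _ _ ((mem_iff_rep_mem _ _).1 hadD))
      (Submodule.smul_mem _ _ ((mem_iff_rep_mem _ _).1 hbdD))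
  have hcdeq : Projectivization.mk F _ hne = pcd := by
    by_contra hcon
    rw [Projectivization.Subspace.mem_submodule_iff _ hne] at hsC hsD
    exact hCD (secant_unique hcon hsC hcdC hsD hcdD)
  have hcdh : hermForm σ (v' - w') (v' - w') = 0 := by
    rw [← mk_mem_unital hσ hne, hcdeq]; exact hcd
  have hspan : Submodule.span F {u, v'} = Submodule.span F {u, v} := by
    apply le_antisymm <;> rw [Submodule.span_le]
    · rintro x (rfl | rfl)
      · exact Submodule.subset_span (by simp)
      · exact Submodule.smul_mem _ _ (Submodule.subset_span (by simp))
    · rintro x (rfl | rfl)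
      · exact Submodule.subset_span (by simp)
      · exact (Submodule.smul_mem_iff _ hvc).1 (Submodule.subset_span (by simp [hv']))
  have hli' : LinearIndependent F ![u, v'] := by
    rw [LinearIndependent.pair_iff] at hli ⊢
    intro s t hst
    have := hli s (t * (a⁻¹ * b)) (by rw [← hst, hv', smul_smul])
    exact ⟨this.1, (mul_eq_zero.1 this.2).resolve_right hvc⟩
  refine not_isotropic_quadrilateral hσσ hli' (w := w') ?_ ((mem_unital hσ _).1 hab)
    (hiso _ hac) (hiso _ hbc) ?_ ?_ hcdh
  · rw [hspan, hw', Submodule.smul_mem_iff _ hwc]; exact hwA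
  · rw [had1]; exact hiso _ had
  · rw [hbd1]; exact hiso _ hbd

end Unital

end HermitianUnital

/-! ### Triangles of linear spaces -/

/-- A linear space: any two points lie on a unique line, and all lines have `k` points. -/
structure IsLinearSpace {P L : Type*} (I : P → L → Prop) (line : P → P → L) (k : ℕ) : Prop where
  left {p p' : P} : p ≠ p' → I p (line p p')
  right {p p' : P} : p ≠ p' → I p' (line p p')
  eq_line {p p' : P} {ℓ : L} : p ≠ p' → I p ℓ → I p' ℓ → ℓ = line p p'
  card (ℓ : L) : Nat.card {p // I p ℓ} = k

namespace IsLinearSpace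

open Finset

variable {P L : Type*} {I : P → L → Prop} {line : P → P → L} {k : ℕ}

lemma line_comm (h : IsLinearSpace I line k) {p p' : P} (hp : p ≠ p') : line p p' = line p' p :=
  h.eq_line hp.symm (h.right hp) (h.left hp)

/-- Three points that do not lie on a line. -/
def Noncollinear (I : P → L → Prop) (line : P → P → L) (t : P × P × P) : Prop :=
  t.2.1 ≠ t.2.2 ∧ ¬ I t.1 (line t.2.1 t.2.2)

lemma ne12 (h : IsLinearSpace I line k) {x y z : P} (ht : Noncollinear I line (x, y, z)) :
    x ≠ y := by
  rintro rfl; exact ht.2 (h.left ht.1)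

lemma ne13 (h : IsLinearSpace I line k) {x y z : P} (ht : Noncollinear I line (x, y, z)) :
    x ≠ z := by
  rintro rfl; exact ht.2 (h.right ht.1)

lemma noncollinear_swap23 (h : IsLinearSpace I line k) {x y z : P}
    (ht : Noncollinear I line (x, y, z)) : Noncollinear I line (x, z, y) := by
  refine ⟨ht.1.symm, ?_⟩
  have := ht.2
  rwa [h.line_comm ht.1] at this

lemma noncollinear_swap12 (h : IsLinearSpace I line k) {x y z : P}
    (ht : Noncollinear I line (x, y, z)) : Noncollinear I line (y, x, z) := by
  refine ⟨h.ne13 ht, fun hy => ht.2 ?_⟩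
  simp only at hy ⊢
  rw [← h.eq_line ht.1 hy (h.right (h.ne13 ht))]
  exact h.left (h.ne13 ht)

lemma noncollinear_rotate (h : IsLinearSpace I line k) {x y z : P}
    (ht : Noncollinear I line (x, y, z)) : Noncollinear I line (y, z, x) :=
  h.noncollinear_swap23 (h.noncollinear_swap12 ht)

lemma line_ne_line (h : IsLinearSpace I line k) {x y z : P}
    (ht : Noncollinear I line (x, y, z)) : line x y ≠ line x z := by
  intro he
  have := h.noncollinear_rotate (h.noncollinear_rotate ht)
  exact this.2 (he ▸ h.right (h.ne13 ht))

/-- The point `x` is the only common point of the sides `xy` and `xz`. -/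
lemma eq_of_mem_of_mem (h : IsLinearSpace I line k) {x y z p : P}
    (ht : Noncollinear I line (x, y, z)) (hp : I p (line x y)) (hp' : I p (line x z)) :
    p = x := by
  by_contra hne
  apply h.line_ne_line ht
  rw [h.eq_line hne hp (h.left (h.ne12 ht)), h.eq_line hne hp' (h.left (h.ne13 ht))]

/-! ### Triangles of lines versus ordered triples of points -/

section Sides

variable [DecidableEq L]

/-- The set of side lines of a triangle of points. -/
def sides (line : P → P → L) (t : P × P × P) : Finset L :=
  {line t.2.1 t.2.2, line t.1 t.2.2, line t.1 t.2.1}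

lemma sides_swap23 (h : IsLinearSpace I line k) {x y z : P}
    (ht : Noncollinear I line (x, y, z)) : sides line (x, z, y) = sides line (x, y, z) := by
  simp only [sides]
  rw [h.line_comm ht.1, Finset.pair_comm]

lemma sides_swap12 (h : IsLinearSpace I line k) {x y z : P}
    (ht : Noncollinear I line (x, y, z)) : sides line (y, x, z) = sides line (x, y, z) := by
  simp only [sides]
  rw [h.line_comm (h.ne12 ht), Finset.insert_comm]

/-- The vertices are recovered as the intersections of pairs of sides, so a permutation of the sides
comes from a permutation of the vertices. -/
lemma perm_of_sides_eq (h : IsLinearSpace I line k) {x y z x' y' z' : P}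
    (ht : Noncollinear I line (x, y, z)) (ht' : Noncollinear I line (x', y', z'))
    (he : sides line (x', y', z') = sides line (x, y, z)) :
    (x', y', z') = (x, y, z) ∨ (x', y', z') = (x, z, y) ∨ (x', y', z') = (y, x, z) ∨
      (x', y', z') = (y, z, x) ∨ (x', y', z') = (z, x, y) ∨ (x', y', z') = (z, y, x) := by
  have hx : ∀ p, I p (line x y) → I p (line x z) → p = x := fun p => h.eq_of_mem_of_mem ht
  have hy : ∀ p, I p (line y z) → I p (line x y) → p = y := fun p h1 h2 =>
    h.eq_of_mem_of_mem (h.noncollinear_rotate ht) h1 (h.line_comm (h.ne12 ht) ▸ h2)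
  have hz : ∀ p, I p (line x z) → I p (line y z) → p = z := fun p h1 h2 =>
    h.eq_of_mem_of_mem (h.noncollinear_rotate (h.noncollinear_rotate ht))
      (h.line_comm (h.ne13 ht) ▸ h1) (h.line_comm ht.1 ▸ h2)
  have n1 := h.ne12 ht'
  have n2 := h.ne13 ht'
  have n3 := ht'.1
  have d1 := h.line_ne_line ht'
  have d2 := h.line_ne_line (h.noncollinear_swap12 ht')
  rw [← h.line_comm n1] at d2
  have d3 := h.line_ne_line (h.noncollinear_rotate (h.noncollinear_rotate ht'))
  rw [← h.line_comm n2, ← h.line_comm n3] at d3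
  have x1 := h.left n1
  have x2 := h.left n2
  have y1 := h.right n1
  have y2 := h.left n3
  have z1 := h.right n2
  have z2 := h.right n3
  have m1 : line y' z' ∈ sides line (x, y, z) := he ▸ by simp [sides]
  have m2 : line x' z' ∈ sides line (x, y, z) := he ▸ by simp [sides]
  have m3 : line x' y' ∈ sides line (x, y, z) := he ▸ by simp [sides]
  simp only [sides, Finset.mem_insert, Finset.mem_singleton] at m1 m2 m3
  simp only [Prod.mk.injEq]
  -- Of the 27 assignments of sides, those that are not injective contradict `d1`, `d2` or `d3`; the
  -- other six give the six permutations.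
  rcases m1 with m1 | m1 | m1 <;> rcases m2 with m2 | m2 | m2 <;>
    first
    | exact absurd (m2.trans m1.symm) d3
    | rcases m3 with m3 | m3 | m3 <;>
      first
      | exact absurd (m3.trans m1.symm) d2
      | exact absurd (m3.trans m2.symm) d1
      | rw [m1] at y2 z2
        rw [m2] at x2 z1
        rw [m3] at x1 y1
        first
        | exact Or.inl ⟨hx _ x1 x2, hy _ y2 y1, hz _ z1 z2⟩
        | exact Or.inr (Or.inl ⟨hx _ x2 x1, hz _ y1 y2, hy _ z2 z1⟩)
        | exact Or.inr (Or.inr (Or.inl ⟨hy _ x2 x1, hx _ y1 y2, hz _ z2 z1⟩))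
        | exact Or.inr (Or.inr (Or.inr (Or.inl ⟨hy _ x1 x2, hz _ y2 y1, hx _ z1 z2⟩)))
        | exact Or.inr (Or.inr (Or.inr (Or.inr (Or.inl ⟨hz _ x1 x2, hx _ y2 y1, hy _ z1 z2⟩))))
        | exact Or.inr (Or.inr (Or.inr (Or.inr (Or.inr ⟨hz _ x2 x1, hy _ y1 y2, hx _ z2 z1⟩))))

lemma card_perms [DecidableEq P] {x y z : P} (hxy : x ≠ y) (hxz : x ≠ z) (hyz : y ≠ z) :
    ({(x, y, z), (x, z, y), (y, x, z), (y, z, x), (z, x, y), (z, y, x)} :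
      Finset (P × P × P)).card = 6 := by
  simp [hxy, hxz, hyz, hxy.symm, hxz.symm, hyz.symm]

end Sides

/-! ### Double counting of split triples -/

section Counting

open scoped Classical in
/-- The ordered triples of noncollinear points. -/
noncomputable def triples [Fintype P] (I : P → L → Prop) (line : P → P → L) :
    Finset (P × P × P) := univ.filter (Noncollinear I line)

open scoped Classical in
/-- The triangles of the linear space, as sets of three lines. -/
noncomputable def triangles [Fintype P] [DecidableEq L] (I : P → L → Prop) (line : P → P → L) :
    Finset (Finset L) :=
  (triples I line).image (sides line)

open scoped Classical in
/-- The points of a line. -/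
noncomputable def points [Fintype P] (I : P → L → Prop) (ℓ : L) : Finset P := univ.filter (I · ℓ)

variable [Fintype P]

lemma card_points (h : IsLinearSpace I line k) (ℓ : L) : (points I ℓ).card = k := by
  classical
  rw [← h.card ℓ, Nat.card_eq_fintype_card, Fintype.card_subtype, points]

open scoped Classical in
/-- Every triangle comes from six ordered triples. -/
lemma card_triples_filter [DecidableEq L] (h : IsLinearSpace I line k) (Q : Finset L → Prop) :
    ((triples I line).filter fun t => Q (sides line t)).card =
      6 * ((triangles I line).filter Q).card := by
  have hmap : ∀ t ∈ (triples I line).filter fun t => Q (sides line t),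
      sides line t ∈ (triangles I line).filter Q := by
    intro t ht
    rw [mem_filter] at ht ⊢
    exact ⟨mem_image_of_mem _ ht.1, ht.2⟩
  rw [card_eq_sum_card_fiberwise hmap, mul_comm, ← smul_eq_mul, ← Finset.sum_const]
  refine Finset.sum_congr rfl fun s hs => ?_
  rw [mem_filter, triangles, mem_image] at hs
  obtain ⟨⟨⟨x, y, z⟩, ht, rfl⟩, hQ⟩ := hs
  have ht : Noncollinear I line (x, y, z) := by simpa [triples] using ht
  rw [← card_perms (h.ne12 ht) (h.ne13 ht) ht.1]
  congr 1
  ext ⟨x', y', z'⟩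
  simp only [triples, mem_filter, mem_univ, true_and, mem_insert, mem_singleton]
  have h12 := h.noncollinear_swap12 ht
  have h23 := h.noncollinear_swap23 ht
  have h123 := h.noncollinear_swap23 h12
  have h132 := h.noncollinear_swap12 h23
  have h13 := h.noncollinear_swap12 h123
  have e12 := h.sides_swap12 ht
  have e23 := h.sides_swap23 ht
  have e123 := (h.sides_swap23 h12).trans e12
  have e132 := (h.sides_swap12 h23).trans e23
  have e13 := (h.sides_swap12 h123).trans e123
  constructor
  · rintro ⟨⟨ht', -⟩, he⟩
    exact h.perm_of_sides_eq ht ht' he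
  · rintro (he | he | he | he | he | he) <;> rw [he]
    exacts [⟨⟨ht, hQ⟩, rfl⟩, ⟨⟨h23, e23 ▸ hQ⟩, e23⟩, ⟨⟨h12, e12 ▸ hQ⟩, e12⟩,
      ⟨⟨h123, e123 ▸ hQ⟩, e123⟩, ⟨⟨h132, e132 ▸ hQ⟩, e132⟩, ⟨⟨h13, e13 ▸ hQ⟩, e13⟩]

/-- Ordered pairs of distinct points are grouped by the line joining them. -/
lemma card_lines [Fintype L] (h : IsLinearSpace I line k) :
    Fintype.card P * (Fintype.card P - 1) = Fintype.card L * (k * (k - 1)) := by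
  classical
  have h1 : (univ : Finset P).offDiag.card = Fintype.card P * (Fintype.card P - 1) := by
    rw [offDiag_card, card_univ, Nat.mul_sub_one]
  rw [← h1, card_eq_sum_card_fiberwise (f := fun x => line x.1 x.2) (t := univ)
    (fun _ _ => mem_coe.2 (mem_univ _))]
  rw [← card_univ, ← smul_eq_mul (α := ℕ), ← Finset.sum_const]
  refine Finset.sum_congr rfl fun ℓ _ => ?_
  have h2 : (points I ℓ).offDiag.card = k * (k - 1) := by
    rw [offDiag_card, h.card_points, Nat.mul_sub_one]
  rw [← h2]
  congr 1
  ext ⟨x, y⟩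
  simp only [mem_filter, mem_offDiag, mem_univ, true_and, points]
  constructor
  · rintro ⟨hxy, rfl⟩; exact ⟨h.left hxy, h.right hxy, hxy⟩
  · rintro ⟨hx, hy, hxy⟩; exact ⟨hxy, (h.eq_line hxy hx hy).symm⟩

/-- If the number of points exceeds the size of a line, there are noncollinear triples. -/
lemma triples_nonempty [Nonempty L] (h : IsLinearSpace I line k) (hk : 2 ≤ k)
    (hP : k < Fintype.card P) : (triples I line).Nonempty := by
  classical
  obtain ⟨ℓ⟩ := ‹Nonempty L›
  have hc := h.card_points ℓ
  obtain ⟨y, hy, z, hz, hyz⟩ := Finset.one_lt_card.1 (by omega : 1 < (points I ℓ).card)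
  obtain ⟨x, -, hx⟩ := Finset.exists_mem_notMem_of_card_lt_card
    (by rw [hc, card_univ]; exact hP : (points I ℓ).card < (univ : Finset P).card)
  simp only [points, mem_filter, mem_univ, true_and] at hy hz hx
  refine ⟨(x, y, z), ?_⟩
  simp only [triples, mem_filter, mem_univ, true_and]
  exact ⟨hyz, by rwa [← h.eq_line hyz hy hz]⟩

/-- If the colour classes have sizes `a` and `b`, there are `2ab` bichromatic ordered pairs, and
`4ab ≤ (a + b) ^ 2`. The factor `s.card - 1` avoids division by the number of all pairs. -/
lemma card_offDiag_filter_ne {α : Type*} [DecidableEq α] (s : Finset α) (χ : α → Fin 2) :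
    2 * (s.card - 1) * (s.offDiag.filter fun x => χ x.1 ≠ χ x.2).card ≤
      s.card * s.offDiag.card := by
  set a := (s.filter fun x => χ x = 0).card with ha
  set b := (s.filter fun x => ¬ χ x = 0).card with hb
  have hab : a + b = s.card := Finset.card_filter_add_card_filter_not _
  have hsub : (s.offDiag.filter fun x => χ x.1 ≠ χ x.2) ⊆
      (s.filter fun x => χ x = 0) ×ˢ (s.filter fun x => ¬ χ x = 0) ∪
      (s.filter fun x => ¬ χ x = 0) ×ˢ (s.filter fun x => χ x = 0) := by
    rintro ⟨x, y⟩ hx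
    simp only [mem_filter, mem_offDiag] at hx
    simp only [mem_union, mem_product, mem_filter]
    have : ∀ i j : Fin 2, i ≠ j → (i = 0 ∧ ¬ j = 0) ∨ (¬ i = 0 ∧ j = 0) := by decide
    have := this _ _ hx.2
    tauto
  have hle := (card_le_card hsub).trans (card_union_le _ _)
  rw [card_product, card_product, ← ha, ← hb] at hle
  have h4 : 2 * (a * b + b * a) ≤ s.card * s.card := by
    rw [← hab]; nlinarith [two_mul_le_add_sq (a : ℕ) b]
  rw [offDiag_card, ← Nat.mul_sub_one, ← mul_assoc]
  calc _ = (s.card - 1) * (2 * (s.offDiag.filter fun x => χ x.1 ≠ χ x.2).card) := by ring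
    _ ≤ (s.card - 1) * (s.card * s.card) :=
      Nat.mul_le_mul_left _ ((Nat.mul_le_mul_left 2 hle).trans h4)
    _ = _ := by ring

variable (c : L → L → Fin 2)

open scoped Classical in
/-- The triples whose two sides at the first point have different colours relative to the side
opposite to it. -/
noncomputable def splitTriples (I : P → L → Prop) (line : P → P → L) (c : L → L → Fin 2) :
    Finset (P × P × P) :=
  (triples I line).filter fun t =>
    c (line t.2.1 t.2.2) (line t.1 t.2.1) ≠ c (line t.2.1 t.2.2) (line t.1 t.2.2)

/-- Triples are grouped by the first point `x` and the opposite side `ℓ`. Within a group, being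
split means that two points of `ℓ` differ in the colouring `y ↦ c ℓ (line x y)`, so
`card_offDiag_filter_ne` applies. -/
lemma card_splitTriples_le [Fintype L] (h : IsLinearSpace I line k) :
    2 * (k - 1) * (splitTriples I line c).card ≤ k * (triples I line).card := by
  classical
  rw [card_eq_sum_card_fiberwise (s := splitTriples I line c)
      (f := fun t => (t.1, line t.2.1 t.2.2)) (t := univ) (fun _ _ => mem_coe.2 (mem_univ _)),
    card_eq_sum_card_fiberwise (s := triples I line)
      (f := fun t => (t.1, line t.2.1 t.2.2)) (t := univ) (fun _ _ => mem_coe.2 (mem_univ _)),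
    mul_sum, mul_sum]
  refine Finset.sum_le_sum ?_
  rintro ⟨x, ℓ⟩ -
  have hinj : Function.Injective (fun yz : P × P => (x, yz)) := fun _ _ h => (Prod.mk.inj h).2
  by_cases hx : I x ℓ
  · have : (splitTriples I line c).filter (fun t => (t.1, line t.2.1 t.2.2) = (x, ℓ)) = ∅ := by
      rw [filter_eq_empty_iff]
      rintro ⟨x', y, z⟩ ht he
      simp only [splitTriples, triples, mem_filter, mem_univ, true_and] at ht
      simp only [Prod.mk.injEq] at he
      apply ht.1.2
      simpa only [he.1, he.2] using hx
    rw [this]; simp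
  · have h1 : (triples I line).filter (fun t => (t.1, line t.2.1 t.2.2) = (x, ℓ)) =
        (points I ℓ).offDiag.image (fun yz => (x, yz)) := by
      ext ⟨x', y, z⟩
      simp only [triples, points, mem_filter, mem_univ, true_and, mem_image, mem_offDiag,
        Prod.exists, Prod.mk.injEq]
      constructor
      · rintro ⟨ht, rfl, rfl⟩
        exact ⟨y, z, ⟨h.left ht.1, h.right ht.1, ht.1⟩, rfl, rfl, rfl⟩
      · rintro ⟨y', z', ⟨hy, hz, hyz⟩, rfl, rfl, rfl⟩
        have := h.eq_line hyz hy hz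
        exact ⟨⟨hyz, by rwa [← this]⟩, rfl, this.symm⟩
    have h2 : (splitTriples I line c).filter (fun t => (t.1, line t.2.1 t.2.2) = (x, ℓ)) =
        ((points I ℓ).offDiag.filter fun yz => c ℓ (line x yz.1) ≠ c ℓ (line x yz.2)).image
          (fun yz => (x, yz)) := by
      rw [splitTriples, filter_comm, h1, filter_image]
      congr 1
      refine filter_congr ?_
      rintro ⟨y, z⟩ hyz
      simp only [points, mem_filter, mem_univ, true_and, mem_offDiag] at hyz
      simp only [← h.eq_line hyz.2.2 hyz.1 hyz.2.1]
    rw [h1, h2, card_image_of_injective _ hinj, card_image_of_injective _ hinj]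
    have := card_offDiag_filter_ne (points I ℓ) (fun y => c ℓ (line x y))
    rwa [h.card_points] at this

open scoped Classical in
/-- A triangle is split at exactly two of its vertices unless it is monochromatic. -/
lemma three_mul_card_splitTriples (h : IsLinearSpace I line k) (hc : ∀ ℓ m, c ℓ m = c m ℓ) :
    3 * (splitTriples I line c).card = 2 * ((triples I line).filter fun t =>
      ¬ (c (line t.2.1 t.2.2) (line t.1 t.2.1) = c (line t.2.1 t.2.2) (line t.1 t.2.2) ∧
        c (line t.2.1 t.2.2) (line t.1 t.2.1) = c (line t.1 t.2.2) (line t.1 t.2.1))).card := by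
  let ρ : P × P × P → P × P × P := fun t => (t.2.1, t.2.2, t.1)
  have hρ : ∀ t ∈ triples I line, ρ t ∈ triples I line := by
    rintro ⟨x, y, z⟩ ht
    simp only [triples, mem_filter, mem_univ, true_and] at ht ⊢
    exact h.noncollinear_rotate ht
  have hρ3 : ∀ t, ρ (ρ (ρ t)) = t := fun _ => rfl
  have hsum : ∀ f : P × P × P → ℕ,
      ∑ t ∈ triples I line, f t = ∑ t ∈ triples I line, f (ρ t) := fun f =>
    (Finset.sum_nbij' ρ (ρ ∘ ρ) hρ (fun t ht => hρ _ (hρ _ ht)) (fun _ _ => rfl)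
      (fun _ _ => rfl) (fun _ _ => rfl)).symm
  let f : P × P × P → ℕ := fun t =>
    if c (line t.2.1 t.2.2) (line t.1 t.2.1) ≠ c (line t.2.1 t.2.2) (line t.1 t.2.2) then 1 else 0
  have h1 : (splitTriples I line c).card = ∑ t ∈ triples I line, f t := by
    rw [splitTriples, card_filter]
  have h2 := hsum f
  have h3 := hsum (fun t => f (ρ t))
  have h4 : 3 * (splitTriples I line c).card =
      ∑ t ∈ triples I line, (f t + f (ρ t) + f (ρ (ρ t))) := by
    rw [sum_add_distrib, sum_add_distrib, h1]; omega
  rw [h4, card_filter, mul_sum]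
  refine Finset.sum_congr rfl ?_
  rintro ⟨x, y, z⟩ ht
  simp only [triples, mem_filter, mem_univ, true_and] at ht
  have e1 := h.line_comm (h.ne12 ht)
  have e2 := h.line_comm (h.ne13 ht)
  have e3 := h.line_comm ht.1
  simp only at e3
  simp only [f, ρ, ← e1, ← e2, ← e3]
  rw [hc (line x z) (line y z), hc (line x y) (line x z), hc (line x y) (line y z)]
  generalize c (line y z) (line x z) = a
  generalize c (line y z) (line x y) = b
  generalize c (line x z) (line x y) = d
  revert a b d
  decide

open scoped Classical in
/-- The bound on the number of triangles that are not monochromatic. -/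
lemma card_not_mono_le [Fintype L] [DecidableEq L] (h : IsLinearSpace I line k)
    (hc : ∀ ℓ m, c ℓ m = c m ℓ)
    (Q : Finset L → Prop)
    (hQ : ∀ t ∈ triples I line, Q (sides line t) ↔
      (c (line t.2.1 t.2.2) (line t.1 t.2.1) = c (line t.2.1 t.2.2) (line t.1 t.2.2) ∧
        c (line t.2.1 t.2.2) (line t.1 t.2.1) = c (line t.1 t.2.2) (line t.1 t.2.1))) :
    4 * (k - 1) * ((triangles I line).filter fun t => ¬ Q t).card ≤
      3 * k * (triangles I line).card := by
  have h1 : ((triples I line).filter fun t => ¬ Q (sides line t)).card =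
      6 * ((triangles I line).filter fun t => ¬ Q t).card := by
    convert h.card_triples_filter (fun t => ¬ Q t)
  have h2 := h.card_triples_filter (fun _ => True)
  simp only [filter_true] at h2
  have h3 := card_splitTriples_le c h
  have h4 := three_mul_card_splitTriples c h hc
  rw [← filter_congr fun t ht => not_congr (hQ t ht), h1] at h4
  rw [h2] at h3
  -- Each triangle gives six triples, so `h4` reads `3 * split = 2 * 6 * nonmonochromatic`.
  have h5 : (splitTriples I line c).card = 4 * ((triangles I line).filter fun t => ¬ Q t).card := by
    omega
  rw [h5] at h3
  nlinarith

end Counting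

end IsLinearSpace

/-! ### Edge colourings as symmetric functions of two vertices -/

namespace QuasiFolkman

variable {V : Type v} {G : SimpleGraph V}

open scoped Classical in
/-- The colour of a pair of vertices, with a default value for nonadjacent pairs. -/
noncomputable def pairColour (Δ : G.edgeSet → Fin 2) (a b : V) : Fin 2 :=
  if h : G.Adj a b then Δ ⟨s(a, b), h⟩ else 0

lemma pairColour_comm (Δ : G.edgeSet → Fin 2) (a b : V) : pairColour Δ a b = pairColour Δ b a := by
  unfold pairColour
  by_cases h : G.Adj a b
  · rw [dif_pos h, dif_pos h.symm]
    congr 2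
    exact Sym2.eq_swap
  · rw [dif_neg h, dif_neg fun h' => h h'.symm]

/-- The two equations are arranged to match the condition on `Q` in `card_not_mono_le`, with `a, b,
c` in the order of `sides`. -/
lemma isMonochromatic_triple [DecidableEq V] (Δ : G.edgeSet → Fin 2) {a b c : V}
    (hab : G.Adj a b) (hac : G.Adj a c) (hbc : G.Adj b c) :
    IsMonochromatic Δ {a, b, c} ↔
      pairColour Δ a c = pairColour Δ a b ∧ pairColour Δ a c = pairColour Δ b c := by
  have key : ∀ {x y : V} (h : G.Adj x y), pairColour Δ x y = Δ ⟨s(x, y), h⟩ := fun h => dif_pos h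
  constructor
  · rintro ⟨i, hi⟩
    rw [key hab, key hac, key hbc, hi, hi, hi]
    · simp
    all_goals
      intro x hx
      simp only [Sym2.mem_iff] at hx
      rcases hx with rfl | rfl <;> simp
  · rintro ⟨h1, h2⟩
    refine ⟨pairColour Δ a c, ?_⟩
    rintro ⟨e, he⟩ hx
    induction e using Sym2.ind with
    | _ x y =>
      have hxy : G.Adj x y := he
      rw [← key hxy]
      have hx1 := hx x (Sym2.mem_mk_left x y)
      have hy1 := hx y (Sym2.mem_mk_right x y)
      simp only [Finset.mem_insert, Finset.mem_singleton] at hx1 hy1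
      have hne := hxy.ne
      have s1 := pairColour_comm Δ a b
      have s2 := pairColour_comm Δ a c
      have s3 := pairColour_comm Δ b c
      rcases hx1 with rfl | rfl | rfl <;> rcases hy1 with rfl | rfl | rfl <;>
        first
        | exact absurd rfl hne
        | rfl
        | exact h1.symm
        | exact h2.symm
        | exact s2.symm
        | exact (h1.trans s1).symm
        | exact (h2.trans s3).symm

end QuasiFolkman

/-! ### The unital as a linear space and the properties of its triangles -/

namespace HermitianUnital

open QuasiFolkman IsLinearSpace

variable {q : ℕ} {F : Type u} [Field F]

/-- Incidence of points of the unital with secants. -/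
def Incident (q : ℕ) (F : Type u) [Field F] (p : unital q F) (ℓ : secants q F) : Prop :=
  p.1 ∈ ℓ.1

lemma finite_secants (hq : IsPrimePow q) (hF : Nat.card F = q ^ 2) : Finite (secants q F) := by
  have := finite_of_card hq.two_le hF
  have : Finite (Projectivization.Subspace F (Fin 3 → F)) :=
    Finite.of_injective _ (SetLike.coe_injective (A := Projectivization.Subspace F (Fin 3 → F)))
  infer_instance

lemma finite_unital (hq : IsPrimePow q) (hF : Nat.card F = q ^ 2) : Finite (unital q F) := by
  have := finite_of_card hq.two_le hF
  infer_instance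

lemma nonempty_secants (hq : IsPrimePow q) (hF : Nat.card F = q ^ 2) : Nonempty (secants q F) := by
  have := finite_unital hq hF
  have h1 : 1 < (unital q F).ncard := by
    rw [ncard_unital hq hF]
    have := pow_pos (by have := hq.two_le; omega : 0 < q) 3
    omega
  obtain ⟨p, hp, p', hp', hne⟩ := (Set.one_lt_ncard (Set.toFinite _)).1 h1
  exact ⟨(exists_secant hq hF hne hp hp').choose⟩

lemma card_incident (ℓ : secants q F) : Nat.card {p // Incident q F p ℓ} = q + 1 := by
  rw [← ℓ.2.2, ← Nat.card_coe_set_eq]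
  exact Nat.card_congr
    { toFun := fun p => ⟨p.1.1, p.2, p.1.2⟩
      invFun := fun p => ⟨⟨p.1, p.2.2⟩, p.2.1⟩
      left_inv := fun _ => rfl
      right_inv := fun _ => rfl }

/-- The points of the unital and the secants form a linear space. -/
lemma exists_isLinearSpace (hq : IsPrimePow q) (hF : Nat.card F = q ^ 2) :
    ∃ line : unital q F → unital q F → secants q F,
      IsLinearSpace (Incident q F) line (q + 1) := by
  have := nonempty_secants hq hF
  have hex : ∀ p p' : unital q F, p ≠ p' → ∃ ℓ : secants q F,
      Incident q F p ℓ ∧ Incident q F p' ℓ := fun p p' h =>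
    exists_secant hq hF (fun he => h (Subtype.ext he)) p.2 p'.2
  choose! line hline using hex
  exact ⟨line, fun h => (hline _ _ h).1, fun h => (hline _ _ h).2, fun h h1 h2 =>
    secant_unique (fun he => h (Subtype.ext he)) h1 h2 (hline _ _ h).1 (hline _ _ h).2,
    card_incident⟩

lemma card_secants (hq : IsPrimePow q) (hF : Nat.card F = q ^ 2) :
    Nat.card (secants q F) = q ^ 4 - q ^ 3 + q ^ 2 := by
  have := finite_secants hq hF
  have := finite_unital hq hF
  have := Fintype.ofFinite (secants q F)
  have := Fintype.ofFinite (unital q F)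
  obtain ⟨line, h⟩ := exists_isLinearSpace hq hF
  have hc := h.card_lines
  have hU := ncard_unital hq hF
  rw [← Nat.card_coe_set_eq, Nat.card_eq_fintype_card] at hU
  rw [hU, ← Nat.card_eq_fintype_card (α := secants q F)] at hc
  simp only [Nat.add_sub_cancel] at hc
  have hq0 : 0 < q := by have := hq.two_le; omega
  -- The count is solved through `q ^ 3 + 1 = (q + 1) * (q ^ 2 - q + 1)`.
  refine Nat.eq_of_mul_eq_mul_right (by positivity : 0 < (q + 1) * q) ?_
  rw [← hc]
  have hle : q ^ 3 ≤ q ^ 4 := Nat.pow_le_pow_right hq0 (by norm_num)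
  zify [hle]
  ring

section Triangles

variable {line : unital q F → unital q F → secants q F}

lemma graph_adj_of_incident {ℓ m : secants q F} (hne : ℓ ≠ m) {p : unital q F}
    (h1 : Incident q F p ℓ) (h2 : Incident q F p m) : (graph q F).Adj ℓ m :=
  ⟨hne, p.1, p.2, h1, h2⟩

/-- Three secants with distinct intersection points are the joins of these points. The points are
noncollinear, since otherwise two of the secants would share two points and coincide. -/
lemma nondegenerateTriangles_eq [Fintype (unital q F)]
    [DecidableEq (secants q F)] (h : IsLinearSpace (Incident q F) line (q + 1)) :
    nondegenerateTriangles q F = ↑(triangles (Incident q F) line) := by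
  classical
  ext t
  simp only [triangles, triples, Finset.coe_image, Finset.coe_filter, Finset.mem_univ, true_and,
    Set.mem_image, Set.mem_ofPred_eq]
  constructor
  · rintro ⟨ℓ₁, ℓ₂, ℓ₃, ht, h12, h13, h23, p₁₂, hu12, p₁₃, hu13, p₂₃, hu23, ⟨m1, m2⟩, ⟨m3, m4⟩,
      ⟨m5, m6⟩, n1, n2, n3⟩
    have n1' : (⟨p₁₂, hu12⟩ : unital q F) ≠ ⟨p₁₃, hu13⟩ := fun he => n1 (congrArg Subtype.val he)
    have n2' : (⟨p₁₂, hu12⟩ : unital q F) ≠ ⟨p₂₃, hu23⟩ := fun he => n2 (congrArg Subtype.val he)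
    have n3' : (⟨p₁₃, hu13⟩ : unital q F) ≠ ⟨p₂₃, hu23⟩ := fun he => n3 (congrArg Subtype.val he)
    have e1 : ℓ₁ = line ⟨p₁₂, hu12⟩ ⟨p₁₃, hu13⟩ := h.eq_line n1' m1 m3
    have e2 : ℓ₂ = line ⟨p₁₂, hu12⟩ ⟨p₂₃, hu23⟩ := h.eq_line n2' m2 m5
    have e3 : ℓ₃ = line ⟨p₁₃, hu13⟩ ⟨p₂₃, hu23⟩ := h.eq_line n3' m4 m6
    refine ⟨(⟨p₁₂, hu12⟩, ⟨p₁₃, hu13⟩, ⟨p₂₃, hu23⟩), ⟨n3', ?_⟩, ?_⟩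
    · rw [← e3]
      intro hI
      exact h13 (secant_unique n1 m1 m3 hI m4)
    · apply Finset.coe_injective
      rw [ht]
      simp only [sides, ← e1, ← e2, ← e3, Finset.coe_insert, Finset.coe_singleton]
      ext m
      simp only [Set.mem_insert_iff, Set.mem_singleton_iff]
      tauto
  · rintro ⟨⟨x, y, z⟩, ht, rfl⟩
    have d1 := h.line_ne_line ht
    have d2 := h.line_ne_line (h.noncollinear_swap12 ht)
    rw [← h.line_comm (h.ne12 ht)] at d2
    have d3 := h.line_ne_line (h.noncollinear_rotate (h.noncollinear_rotate ht))
    rw [← h.line_comm (h.ne13 ht), ← h.line_comm ht.1] at d3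
    have n1 := h.ne12 ht
    have n2 := h.ne13 ht
    have n3 : y ≠ z := ht.1
    refine ⟨line y z, line x z, line x y, by simp [sides], d3.symm, d2.symm, d1.symm,
      z.1, z.2, y.1, y.2, x.1, x.2, ⟨h.right n3, h.right n2⟩, ⟨h.left n3, h.right n1⟩,
      ⟨h.left n2, h.left n1⟩, ?_, ?_, ?_⟩
    · exact fun he => n3 (Subtype.ext he.symm)
    · exact fun he => n2 (Subtype.ext he.symm)
    · exact fun he => n1 (Subtype.ext he.symm)

lemma isMonochromatic_sides (h : IsLinearSpace (Incident q F) line (q + 1))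
    [DecidableEq (secants q F)] (Δ : (graph q F).edgeSet → Fin 2)
    {t : unital q F × unital q F × unital q F} (ht : Noncollinear (Incident q F) line t) :
    IsMonochromatic Δ (sides line t) ↔
      (pairColour Δ (line t.2.1 t.2.2) (line t.1 t.2.1) =
          pairColour Δ (line t.2.1 t.2.2) (line t.1 t.2.2) ∧
        pairColour Δ (line t.2.1 t.2.2) (line t.1 t.2.1) =
          pairColour Δ (line t.1 t.2.2) (line t.1 t.2.1)) := by
  obtain ⟨x, y, z⟩ := t
  have d1 := h.line_ne_line ht
  have d2 := h.line_ne_line (h.noncollinear_swap12 ht)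
  rw [← h.line_comm (h.ne12 ht)] at d2
  have d3 := h.line_ne_line (h.noncollinear_rotate (h.noncollinear_rotate ht))
  rw [← h.line_comm (h.ne13 ht), ← h.line_comm ht.1] at d3
  have n1 := h.ne12 ht
  have n2 := h.ne13 ht
  have n3 : y ≠ z := ht.1
  exact isMonochromatic_triple Δ (graph_adj_of_incident d3.symm (h.right n3) (h.right n2))
    (graph_adj_of_incident d2.symm (h.left n3) (h.right n1))
    (graph_adj_of_incident d1.symm (h.left n2) (h.left n1))

end Triangles

lemma isNClique_of_mem {t : Finset (secants q F)} (ht : t ∈ nondegenerateTriangles q F) :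
    (graph q F).IsNClique 3 t := by
  classical
  obtain ⟨ℓ₁, ℓ₂, ℓ₃, ht, h12, h13, h23, p₁₂, hu12, p₁₃, hu13, p₂₃, hu23, m1, m2, m3, -⟩ := ht
  rw [SimpleGraph.is3Clique_iff]
  refine ⟨ℓ₁, ℓ₂, ℓ₃, ⟨h12, p₁₂, hu12, m1⟩, ⟨h13, p₁₃, hu13, m2⟩, ⟨h23, p₂₃, hu23, m3⟩, ?_⟩
  apply Finset.coe_injective
  rw [ht]; simp

/-- The lines of a nondegenerate triangle are not concurrent. -/
lemma not_concurrent_of_mem {t : Finset (secants q F)} (ht : t ∈ nondegenerateTriangles q F)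
    (p : ℙ F (Fin 3 → F)) (hp : ∀ ℓ ∈ t, p ∈ ℓ.1) : False := by
  obtain ⟨ℓ₁, ℓ₂, ℓ₃, ht, h12, h13, h23, p₁₂, hu12, p₁₃, hu13, p₂₃, hu23, m1, m2, m3, n1, -⟩ := ht
  have hmem : ∀ ℓ, ℓ ∈ t ↔ ℓ = ℓ₁ ∨ ℓ = ℓ₂ ∨ ℓ = ℓ₃ := fun ℓ => by
    rw [← Finset.mem_coe, ht]; simp
  have p1 := hp ℓ₁ ((hmem _).2 (by simp))
  have p2 := hp ℓ₂ ((hmem _).2 (by simp))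
  have p3 := hp ℓ₃ ((hmem _).2 (by simp))
  have e1 : p = p₁₂ := by
    by_contra hne; exact h12 (secant_unique hne p1 m1.1 p2 m1.2)
  have e2 : p = p₁₃ := by
    by_contra hne; exact h13 (secant_unique hne p1 m2.1 p3 m2.2)
  exact n1 (e1.symm.trans e2)

/-- If all four triangles are non-degenerate, no three of the lines are concurrent, and the six
edges supply the six points of an O'Nan configuration. -/
lemma not_K4_of_nondegenerate (hq : IsPrimePow q) (hF : Nat.card F = q ^ 2)
    (K : Finset (secants q F)) (hK : (graph q F).IsNClique 4 K) :
    ¬ ∀ t ∈ K.powersetCard 3, t ∈ nondegenerateTriangles q F := by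
  classical
  intro hall
  obtain ⟨D, hD⟩ := Finset.card_pos.1 (by rw [hK.card_eq]; norm_num : 0 < K.card)
  obtain ⟨A, B, C, nAB, nAC, nBC, hE⟩ := Finset.card_eq_three.1
    (by rw [Finset.card_erase_of_mem hD, hK.card_eq] : (K.erase D).card = 3)
  obtain ⟨nAD, hA⟩ := Finset.mem_erase.1 (by rw [hE]; simp : A ∈ K.erase D)
  obtain ⟨nBD, hB⟩ := Finset.mem_erase.1 (by rw [hE]; simp : B ∈ K.erase D)
  obtain ⟨nCD, hC⟩ := Finset.mem_erase.1 (by rw [hE]; simp : C ∈ K.erase D)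
  have hnc : ∀ X Y Z : secants q F, X ≠ Y → X ≠ Z → Y ≠ Z →
      X ∈ K → Y ∈ K → Z ∈ K →
      ∀ p, p ∈ X.1 → p ∈ Y.1 → p ∉ Z.1 := by
    intro X Y Z h1 h2 h3 hXK hYK hZK p hX hY hZ
    refine not_concurrent_of_mem (hall {X, Y, Z} ?_) p ?_
    · rw [Finset.mem_powersetCard]
      refine ⟨?_, Finset.card_eq_three.2 ⟨X, Y, Z, h1, h2, h3, rfl⟩⟩
      simp [Finset.insert_subset_iff, hXK, hYK, hZK]
    · intro ℓ hℓ
      simp only [Finset.mem_insert, Finset.mem_singleton] at hℓ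
      rcases hℓ with rfl | rfl | rfl <;> assumption
  have hABC := hnc A B C nAB nAC nBC hA hB hC
  have hABD := hnc A B D nAB nAD nBD hA hB hD
  have hACD := hnc A C D nAC nAD nCD hA hC hD
  have hBCD := hnc B C D nBC nBD nCD hB hC hD
  obtain ⟨-, pab, hab, habA, habB⟩ := hK.isClique hA hB nAB
  obtain ⟨-, pac, hac, hacA, hacC⟩ := hK.isClique hA hC nAC
  obtain ⟨-, pad, had, hadA, hadD⟩ := hK.isClique hA hD nAD
  obtain ⟨-, pbc, hbc, hbcB, hbcC⟩ := hK.isClique hB hC nBC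
  obtain ⟨-, pbd, hbd, hbdB, hbdD⟩ := hK.isClique hB hD nBD
  obtain ⟨hne, pcd, hcd, hcdC, hcdD⟩ := hK.isClique hC hD nCD
  exact no_onan hq hF hab hac hbc had hbd hcd habA habB hacA hacC hbcB hbcC hadA hadD hbdB hbdD
    hcdC hcdD hne hABC hABD hACD hBCD

lemma finite_nondegenerateTriangles (hq : IsPrimePow q) (hF : Nat.card F = q ^ 2) :
    (nondegenerateTriangles q F).Finite := by
  have := finite_secants hq hF
  exact Set.toFinite _

/-- The number of monochromatic nondegenerate triangles. -/
lemma le_ncard_mono (hq : IsPrimePow q) (hF : Nat.card F = q ^ 2)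
    (Δ : (graph q F).edgeSet → Fin 2) :
    q * (nondegenerateTriangles q F).ncard ≤
      4 * q * {t ∈ nondegenerateTriangles q F | IsMonochromatic Δ t}.ncard +
        3 * (nondegenerateTriangles q F).ncard := by
  classical
  have := finite_secants hq hF
  have := finite_unital hq hF
  have := Fintype.ofFinite (secants q F)
  have := Fintype.ofFinite (unital q F)
  obtain ⟨line, h⟩ := exists_isLinearSpace hq hF
  have hle := card_not_mono_le (pairColour Δ) h (pairColour_comm Δ) (IsMonochromatic Δ) (by
    intro t ht
    refine isMonochromatic_sides h Δ ?_
    simpa [triples] using ht)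
  have hT := nondegenerateTriangles_eq h
  have hM : {t ∈ nondegenerateTriangles q F | IsMonochromatic Δ t} =
      ↑((triangles (Incident q F) line).filter (IsMonochromatic Δ)) := by
    rw [hT]; ext; simp
  have hadd := Finset.card_filter_add_card_filter_not (s := triangles (Incident q F) line)
    (IsMonochromatic Δ)
  rw [hM, hT, Set.ncard_coe_finset, Set.ncard_coe_finset]
  simp only [Nat.add_sub_cancel] at hle
  nlinarith

lemma nondegenerateTriangles_nonempty (hq : IsPrimePow q) (hF : Nat.card F = q ^ 2) :
    (nondegenerateTriangles q F).Nonempty := by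
  classical
  have := finite_unital hq hF
  have := Fintype.ofFinite (unital q F)
  have := nonempty_secants hq hF
  obtain ⟨line, h⟩ := exists_isLinearSpace hq hF
  have hq2 := hq.two_le
  have hU := ncard_unital hq hF
  rw [← Nat.card_coe_set_eq, Nat.card_eq_fintype_card] at hU
  obtain ⟨t, ht⟩ := h.triples_nonempty (by omega) (by
    rw [hU]
    have := Nat.pow_lt_pow_right (a := q) (by omega) (by norm_num : 1 < 3)
    rw [pow_one] at this
    omega)
  rw [nondegenerateTriangles_eq h]
  exact ⟨_, Finset.mem_coe.2 (Finset.mem_image_of_mem _ ht)⟩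

lemma isQuasiFolkman (hq4 : 4 ≤ q) (hq : IsPrimePow q) (hF : Nat.card F = q ^ 2) :
    IsQuasiFolkman (graph q F) (nondegenerateTriangles q F) where
  isTriangle _ := isNClique_of_mem
  not_K4 := not_K4_of_nondegenerate hq hF
  exists_mono Δ := by
    have hle := le_ncard_mono hq hF Δ
    have hpos := (Set.ncard_pos (finite_nondegenerateTriangles hq hF)).2
      (nondegenerateTriangles_nonempty hq hF)
    -- Without monochromatic triangles the bound would read `q * |𝒯| ≤ 3 * |𝒯|` with `𝒯` nonempty;
    -- this is where `4 ≤ q` enters.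
    have hne : {t ∈ nondegenerateTriangles q F | IsMonochromatic Δ t}.ncard ≠ 0 := by
      intro h0
      rw [h0] at hle
      nlinarith
    exact Set.nonempty_of_ncard_ne_zero hne

end HermitianUnital

theorem theorem1 :
    (∀ (q : ℕ) (F : Type u) [Field F], 4 ≤ q → IsPrimePow q → Nat.card F = q ^ 2 →
      Nat.card (HermitianUnital.secants q F) = q ^ 4 - q ^ 3 + q ^ 2 ∧
      QuasiFolkman.IsQuasiFolkman (HermitianUnital.graph q F)
        (HermitianUnital.nondegenerateTriangles q F)) ∧
    (∃ δ : ℕ → ℝ, Filter.Tendsto δ Filter.atTop (nhds 0) ∧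
      ∀ (q : ℕ) (F : Type u) [Field F], 4 ≤ q → IsPrimePow q → Nat.card F = q ^ 2 →
        ∀ Δ : (HermitianUnital.graph q F).edgeSet → Fin 2,
          (1 / 4 - δ q) * ((HermitianUnital.nondegenerateTriangles q F).ncard : ℝ) ≤
            (({t ∈ HermitianUnital.nondegenerateTriangles q F |
              QuasiFolkman.IsMonochromatic Δ t}).ncard : ℝ)) := by
  refine ⟨fun q F _ hq4 hq hF =>
    ⟨HermitianUnital.card_secants hq hF, HermitianUnital.isQuasiFolkman hq4 hq hF⟩,
    -- This error term is what remains of `le_ncard_mono` after division by `4 * q`.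
    fun q => (3 / 4) / (q : ℝ), tendsto_const_div_atTop_nhds_zero_nat _, ?_⟩
  intro q F _ hq4 hq hF Δ
  have hle := HermitianUnital.le_ncard_mono hq hF Δ
  have hq0 : (0 : ℝ) < q := by exact_mod_cast (by omega : 0 < q)
  have hle' : (q : ℝ) * ((HermitianUnital.nondegenerateTriangles q F).ncard : ℝ) ≤
      4 * q * (({t ∈ HermitianUnital.nondegenerateTriangles q F |
        QuasiFolkman.IsMonochromatic Δ t}).ncard : ℝ) +
      3 * ((HermitianUnital.nondegenerateTriangles q F).ncard : ℝ) := by exact_mod_cast hle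
  refine le_of_mul_le_mul_left ?_ (by positivity : (0 : ℝ) < 4 * q)
  have : 4 * (q : ℝ) * ((1 / 4 - 3 / 4 / q) *
      ((HermitianUnital.nondegenerateTriangles q F).ncard : ℝ)) =
      q * ((HermitianUnital.nondegenerateTriangles q F).ncard : ℝ) -
        3 * ((HermitianUnital.nondegenerateTriangles q F).ncard : ℝ) := by
    field_simp
  rw [this]
  linarith
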